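/- Let $m$ be a positive integer and $\theta\in(0,1)$ with $\theta^2=1/m$. Define $T_\theta:[0,\theta]\to[0,\theta]$ by $T_\theta(0)=0$ and $$T_\theta(x)=\frac1x-\theta\left\lfloor\frac1{x\theta}\right\rfloor,\qquad 0<x\le\theta,$$ and let $\gamma_\theta$ be the measure $\gamma_\theta(A)=\frac1{\log(1+\theta^2)}\int_A\frac{\theta\,dx}{1+\theta x}$ on the Borel subsets of $[0,\theta]$. Let $\mu$ be a non-atomic Borel probability measure on $[0,\theta]$ that has a Riemann-integrable density with respect to Lebesgue measure, and write $\mu(T_\theta^n<x)=\mu(\{y\in[0,\theta]:T_\theta^n(y)<x\})$. (i) For every $x\in[0,\theta]$, $$\lim_{n\to\infty}\mu(T_\theta^n<x)=\frac{1}{\log(1+\theta^2)}\log\bigl((m\theta+x)\theta\bigr)=\gamma_\theta([0,x]).$$ (ii) If, in addition, $\mu$ has a density that is Lipschitz continuous on $[0,\theta]$, then there exist constants $0<q<1$ and $K>0$ and real numbers $\alpha=\alpha(\mu,n,x)$ such that, for all $n\ge1$ and all $x\in[0,\theta]$, $|\alpha|\le K$ and $$\mu(T_\theta^n<x)=\frac{1+\alpha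 q^n}{\log(1+\theta^2)}\log\bigl((m\theta+x)\theta\bigr).$$ Consequently the error term $e_n(\theta,\mu;x):=\mu(T_\theta^n<x)-\gamma_\theta([0,x])$ satisfies $$e_n(\theta,\mu;x)=\frac{\alpha q^n}{\log(1+\theta^2)}\log\bigl((m\theta+x)\theta\bigr).$$ -/

import Mathlib

open MeasureTheory Filter Topology

noncomputable section

namespace ThetaExpansion

/-- The transformation `T_θ` of `[0, θ]`: `T_θ x = 1/x - θ ⌊1/(xθ)⌋` for `x ≠ 0`, and `T_θ 0 = 0`.
It is written as a map of `ℝ`; only its restriction to `[0, θ]` matters, see `mapsTo_T`. -/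
def T (θ : ℝ) (x : ℝ) : ℝ :=
  if x = 0 then 0 else 1 / x - θ * (⌊1 / (x * θ)⌋ : ℝ)

theorem mapsTo_T {θ : ℝ} (hθ : 0 < θ) : Set.MapsTo (T θ) (Set.Icc 0 θ) (Set.Icc 0 θ) := by
  intro x _
  unfold T
  split_ifs with h
  · exact ⟨le_rfl, hθ.le⟩
  · have h1 : 1 / x = θ * (1 / (x * θ)) := by field_simp
    have h2 := Int.floor_le (1 / (x * θ))
    have h3 := (Int.lt_floor_add_one (1 / (x * θ))).le
    constructor <;> nlinarith

/-- The measure `γ_θ(A) = (1 / log (1 + θ²)) ∫_A θ / (1 + θ x) dx` on `[0, θ]`. -/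
def gammaMeasure (θ : ℝ) : Measure ℝ :=
  (volume.restrict (Set.Icc 0 θ)).withDensity
    fun x => ENNReal.ofReal (1 / Real.log (1 + θ ^ 2) * (θ / (1 + θ * x)))

/-- `μ (T_θⁿ < x)`. -/
def distrib (θ : ℝ) (μ : Measure ℝ) (n : ℕ) (x : ℝ) : ℝ :=
  μ.real {y | y ∈ Set.Icc 0 θ ∧ (T θ)^[n] y < x}

/-- The `n`-th error term `e_n(θ, μ; x) = μ (T_θⁿ < x) - γ_θ([0, x])`. -/
def errorTerm (θ : ℝ) (μ : Measure ℝ) (n : ℕ) (x : ℝ) : ℝ :=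
  distrib θ μ n x - (gammaMeasure θ).real (Set.Icc 0 x)

/-- `h` is a density of `μ` with respect to Lebesgue measure on `[0, θ]`; in particular `μ` is
carried by `[0, θ]`. -/
structure IsDensity (θ : ℝ) (μ : Measure ℝ) (h : ℝ → ℝ) : Prop where
  nonneg : ∀ x ∈ Set.Icc 0 θ, 0 ≤ h x
  aemeasurable : AEMeasurable h (volume.restrict (Set.Icc 0 θ))
  eq_withDensity : μ = (volume.restrict (Set.Icc 0 θ)).withDensity fun x => ENNReal.ofReal (h x)

/-- Riemann integrability of `h` on `[a, b]`, `a < b`: Mathlib's (box) Riemann integral on the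
one-dimensional box with endpoints `a` and `b`. -/
def RiemannIntegrableOn (h : ℝ → ℝ) (a b : ℝ) : Prop :=
  ∃ hab : a < b,
    BoxIntegral.Integrable
      (⟨fun _ => a, fun _ => b, fun _ => hab⟩ : BoxIntegral.Box (Fin 1))
      BoxIntegral.IntegrationParams.Riemann (fun v : Fin 1 → ℝ => h (v 0))
      BoxIntegral.BoxAdditiveMap.volume

/-- Assumption (A): `μ` is non-atomic and has a Riemann-integrable density on `[0, θ]`. -/
def AssumptionA (θ : ℝ) (μ : Measure ℝ) : Prop :=
  NullSingletonClass μ ∧ ∃ h : ℝ → ℝ, IsDensity θ μ h ∧ RiemannIntegrableOn h 0 θ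

/-- `μ` has a density on `[0, θ]` that is Lipschitz continuous there. -/
def HasLipschitzDensity (θ : ℝ) (μ : Measure ℝ) : Prop :=
  ∃ h : ℝ → ℝ, IsDensity θ μ h ∧ ∃ C : NNReal, LipschitzOnWith C h (Set.Icc 0 θ)

end ThetaExpansion

end

namespace ThetaExpansion

/-! This is a Gauss–Kuzmin argument by contraction of Lipschitz constants. Since `1/θ = mθ`, the
branches of `T θ` are full, and pushing the measure with density `g * invDensity θ` forward by `T θ`
replaces `g` by `transfer θ g` (`map_T_densMeasure`). The weights of this operator sum to 1, so
constants are fixed.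

Because `θ < 1` forces `m ≥ 2`, i.e. `θ² ≤ 1/2`, one step multiplies the Lipschitz constant by at
most `5/6` (`abs_transfer_sub_le`). After `n` steps the relative density is constant up to
`O((5/6)^n)`, and conservation of mass identifies the constant; this gives the Lipschitz case
(`exists_abs_map_iterate_real_sub_le`).

A general density is approximated in `L¹` by Lipschitz ones (`exists_densMeasure_near`). The
resulting error is uniform over measurable sets, hence over all preimages under iterates, so the
limit follows without a rate. -/

/-- The inverse branches `x ↦ 1 / (1/θ + x + θ k)` of `T θ`, `k = 0, 1, 2, …`. -/
noncomputable def branch (θ : ℝ) (k : ℕ) (x : ℝ) : ℝ := (1 / θ + x + θ * k)⁻¹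

/-- The (unnormalised) invariant density of `T θ`. -/
noncomputable def invDensity (θ x : ℝ) : ℝ := θ / (1 + θ * x)

/-- The weight of the `k`-th branch in the transfer operator normalised by `invDensity θ`. -/
noncomputable def branchWeight (θ : ℝ) (k : ℕ) (x : ℝ) : ℝ :=
  (1 / θ + x) * θ / ((1 / θ + x + θ * k) * (1 / θ + x + θ * (k + 1)))

/-- The transfer operator of `T θ` with respect to `invDensity θ`. -/
noncomputable def transfer (θ : ℝ) (g : ℝ → ℝ) (x : ℝ) : ℝ :=
  ∑' k : ℕ, branchWeight θ k x * g (branch θ k x)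

/-- The measure on `[0, θ]` with density `g * invDensity θ`. -/
noncomputable def densMeasure (θ : ℝ) (g : ℝ → ℝ) : Measure ℝ :=
  (volume.restrict (Set.Icc 0 θ)).withDensity fun x => ENNReal.ofReal (g x * invDensity θ x)

/-! ### Inverse branches and their weights -/

theorem branch_mem {θ x : ℝ} (hθ : 0 < θ) (hx : 0 ≤ x) (k : ℕ) :
    branch θ k x ∈ Set.Ioc 0 θ := by
  have h0 : 0 < 1 / θ := by positivity
  have hk : 0 ≤ θ * k := by positivity
  refine ⟨by unfold branch; positivity, ?_⟩
  calc branch θ k x ≤ (1 / θ)⁻¹ := by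
        unfold branch
        exact inv_anti₀ h0 (by linarith)
    _ = θ := by simp

theorem branchWeight_nonneg {θ x : ℝ} (hθ : 0 < θ) (hx : 0 ≤ x) (k : ℕ) :
    0 ≤ branchWeight θ k x := by
  unfold branchWeight; positivity

/-- With `X = 1/θ + x`, the weight telescopes as `X/(X + θk) - X/(X + θ(k+1))`. Total weight 1
expresses the invariance of `invDensity θ`. -/
theorem hasSum_branchWeight {θ x : ℝ} (hθ : 0 < θ) (hx : 0 ≤ x) :
    HasSum (fun k => branchWeight θ k x) 1 := by
  rw [hasSum_iff_tendsto_nat_of_nonneg (branchWeight_nonneg hθ hx)]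
  have hX : 0 < 1 / θ + x := by positivity
  have key : ∀ n : ℕ, ∑ k ∈ Finset.range n, branchWeight θ k x
      = 1 - (1 / θ + x) / (1 / θ + x + θ * n) := by
    intro n
    induction n with
    | zero => rw [Nat.cast_zero, mul_zero, add_zero, div_self hX.ne', Finset.sum_range_zero, sub_self]
    | succ n ih =>
      rw [Finset.sum_range_succ, ih, branchWeight]
      push_cast
      generalize 1 / θ + x = X at *
      have h1 : X + θ * n ≠ 0 := by positivity
      have h2 : X + θ * (n + 1) ≠ 0 := by positivity
      field_simp
      ring
  simp_rw [key]
  have h1 : Tendsto (fun n : ℕ => 1 / θ + x + θ * n) atTop atTop :=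
    tendsto_atTop_add_const_left _ _ (tendsto_natCast_atTop_atTop.const_mul_atTop hθ)
  simpa using (h1.const_div_atTop (1 / θ + x)).const_sub 1

theorem abs_branch_sub_le {θ x y : ℝ} (hθ : 0 < θ) (hθ2 : θ ^ 2 ≤ 1 / 2) (hx : 0 ≤ x)
    (hy : 0 ≤ y) (k : ℕ) : |branch θ k x - branch θ k y| ≤ 1 / 2 * |x - y| := by
  have hp := branch_mem hθ hx k
  have hq := branch_mem hθ hy k
  have hX : 1 / θ + x + θ * k ≠ 0 := by positivity
  have hY : 1 / θ + y + θ * k ≠ 0 := by positivity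
  have h : branch θ k x - branch θ k y = branch θ k x * branch θ k y * (y - x) := by
    unfold branch
    generalize 1 / θ = a at *
    field_simp
    ring
  rw [h, abs_mul, abs_of_nonneg (mul_nonneg hp.1.le hq.1.le), abs_sub_comm y x]
  refine mul_le_mul_of_nonneg_right ?_ (abs_nonneg _)
  calc _ ≤ θ * θ := mul_le_mul hp.2 hq.2 hq.1.le hθ.le
    _ ≤ 1 / 2 := by rw [← sq]; exact hθ2

/-- The factor `branch θ k y` comes from bounding `|g (branch θ k y) - g 0|` by a Lipschitz
constant. It supplies the decay in `k` that allows a termwise comparison with `branchWeight θ k x`.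
-/
theorem abs_branchWeight_sub_mul_le {θ x y : ℝ} (hθ : 0 < θ) (hθ2 : θ ^ 2 ≤ 1 / 2) (hx : 0 ≤ x)
    (hy : 0 ≤ y) (k : ℕ) :
    |branchWeight θ k x - branchWeight θ k y| * branch θ k y
      ≤ 1 / 3 * branchWeight θ k x * |x - y| := by
  have hd : |x - y| = |(1 / θ + x) - (1 / θ + y)| := by congr 1; ring
  rw [hd]
  unfold branchWeight branch
  have ha : 2 ≤ 1 / θ * (1 / θ) := by
    rw [← sq, one_div_pow, le_div_iff₀ (by positivity)]; linarith
  have ha0 : 0 < 1 / θ := by positivity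
  have hXa : 1 / θ ≤ 1 / θ + x := by linarith
  have hYa : 1 / θ ≤ 1 / θ + y := by linarith
  have hYθ : 1 ≤ (1 / θ + y) * θ := by
    rw [add_mul, one_div_mul_cancel hθ.ne']; nlinarith
  generalize 1 / θ + x = X at *
  generalize 1 / θ + y = Y at *
  have hX : 0 < X := by linarith
  have hY : 0 < Y := by linarith
  obtain ⟨A, hA, hAk⟩ : ∃ A : ℝ, 0 ≤ A ∧ θ * k = A := ⟨_, by positivity, rfl⟩
  have hB : θ * ((k : ℝ) + 1) = A + θ := by rw [mul_add, hAk, mul_one]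
  rw [hB, hAk]
  have hXY : 2 ≤ X * Y := ha.trans (mul_le_mul hXa hYa ha0.le hX.le)
  have hYY : 2 ≤ Y * Y := ha.trans (mul_le_mul hYa hYa ha0.le hY.le)
  -- What remains after common factors cancel. The part `XY` is controlled by `Y² ≥ 2` and `Yθ ≥ 1`,
  -- the part `A(A + θ)` by `(Y + A)² ≥ 4YA` and `XY ≥ 2`.
  have key : 3 * |X * Y - A * (A + θ)| ≤ X * ((Y + A) ^ 2 * (Y + (A + θ))) := by
    have hbig : Y * 3 ≤ (Y + A) ^ 2 * (Y + (A + θ)) := by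
      calc Y * 3 ≤ Y ^ 2 * (Y + θ) := by nlinarith
        _ ≤ _ := by gcongr <;> linarith
    have hsq : 8 * A ≤ X * (Y + A) ^ 2 := by
      have : X * (4 * (Y * A)) ≤ X * (Y + A) ^ 2 := by
        gcongr; nlinarith [sq_nonneg (Y - A)]
      nlinarith
    have hAB : 8 * A * (A + θ) ≤ X * (Y + A) ^ 2 * (Y + (A + θ)) :=
      mul_le_mul hsq (by linarith) (by positivity) (by positivity)
    have h0 : 0 ≤ A * (A + θ) := by positivity
    have h1 : X * (Y * 3) ≤ X * ((Y + A) ^ 2 * (Y + (A + θ))) := by gcongr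
    have h2 : 0 < X * Y := by positivity
    rw [mul_comm (3 : ℝ), ← le_div_iff₀ (by norm_num), abs_le]
    constructor <;> nlinarith
  have hdiff : X * θ / ((X + A) * (X + (A + θ))) - Y * θ / ((Y + A) * (Y + (A + θ)))
      = θ / ((X + A) * (X + (A + θ)) * ((Y + A) * (Y + (A + θ)))) * (Y - X)
        * (X * Y - A * (A + θ)) := by
    have h1 : X + A ≠ 0 := by positivity
    have h2 : X + (A + θ) ≠ 0 := by positivity
    have h3 : Y + A ≠ 0 := by positivity
    have h4 : Y + (A + θ) ≠ 0 := by positivity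
    field_simp
    ring
  rw [hdiff, abs_mul, abs_mul, abs_sub_comm Y X, abs_of_nonneg (by positivity)]
  have hrhs : 1 / 3 * (X * θ / ((X + A) * (X + (A + θ)))) * |X - Y|
      = θ / ((X + A) * (X + (A + θ)) * ((Y + A) * (Y + (A + θ)))) * |X - Y| * (Y + A)⁻¹
        * (X * ((Y + A) ^ 2 * (Y + (A + θ))) / 3) := by
    field_simp
  rw [hrhs, mul_right_comm]
  refine mul_le_mul_of_nonneg_left ?_ (by positivity)
  rw [le_div_iff₀ (by norm_num)]
  linarith

/-! ### Contraction by the transfer operator -/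

theorem abs_le_of_lipschitz {θ L : ℝ} {g : ℝ → ℝ} (hθ : 0 < θ) (hL : 0 ≤ L)
    (hg : ∀ x ∈ Set.Icc 0 θ, ∀ y ∈ Set.Icc 0 θ, |g x - g y| ≤ L * |x - y|) :
    ∀ x ∈ Set.Icc 0 θ, |g x| ≤ |g 0| + L * θ := by
  intro x hx
  have h := hg x hx 0 ⟨le_rfl, hθ.le⟩
  have h2 : L * |x - 0| ≤ L * θ := by
    rw [sub_zero, abs_of_nonneg hx.1]; exact mul_le_mul_of_nonneg_left hx.2 hL
  have h3 := abs_sub_abs_le_abs_sub (g x) (g 0)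
  linarith

theorem summable_transfer {θ L x : ℝ} {g : ℝ → ℝ} (hθ : 0 < θ) (hL : 0 ≤ L)
    (hg : ∀ x ∈ Set.Icc 0 θ, ∀ y ∈ Set.Icc 0 θ, |g x - g y| ≤ L * |x - y|) (hx : 0 ≤ x) :
    Summable fun k => branchWeight θ k x * g (branch θ k x) := by
  refine Summable.of_norm_bounded
    ((hasSum_branchWeight hθ hx).summable.mul_right (|g 0| + L * θ)) fun k => ?_
  rw [Real.norm_eq_abs, abs_mul, abs_of_nonneg (branchWeight_nonneg hθ hx k)]
  exact mul_le_mul_of_nonneg_left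
    (abs_le_of_lipschitz hθ hL hg _ (Set.Ioc_subset_Icc_self (branch_mem hθ hx k)))
    (branchWeight_nonneg hθ hx k)

/-- The normalised transfer operator contracts Lipschitz constants by the factor `5/6`. -/
theorem abs_transfer_sub_le {θ L : ℝ} {g : ℝ → ℝ} (hθ : 0 < θ) (hθ2 : θ ^ 2 ≤ 1 / 2) (hL : 0 ≤ L)
    (hg : ∀ x ∈ Set.Icc 0 θ, ∀ y ∈ Set.Icc 0 θ, |g x - g y| ≤ L * |x - y|) :
    ∀ x ∈ Set.Icc 0 θ, ∀ y ∈ Set.Icc 0 θ,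
      |transfer θ g x - transfer θ g y| ≤ 5 / 6 * L * |x - y| := by
  intro x hx y hy
  have hwx := hasSum_branchWeight hθ hx.1
  have hwy := hasSum_branchWeight hθ hy.1
  -- Both weight families sum to 1, so `g 0` times their difference can be subtracted for free:
  -- weight differences then multiply `g (branch θ k y) - g 0`. The rate is `5/6 = 1/2 + 1/3`, from
  -- branches and weights respectively.
  have hsum := ((summable_transfer hθ hL hg hx.1).hasSum.sub
    (summable_transfer hθ hL hg hy.1).hasSum).sub ((hwx.sub hwy).mul_right (g 0))
  rw [sub_self, zero_mul, sub_zero] at hsum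
  have hbd := hwx.mul_right (5 / 6 * L * |x - y|)
  rw [one_mul] at hbd
  rw [transfer, transfer, ← hsum.tsum_eq, ← Real.norm_eq_abs]
  refine tsum_of_norm_bounded hbd fun k => ?_
  have hux := Set.Ioc_subset_Icc_self (branch_mem hθ hx.1 k)
  have huy := Set.Ioc_subset_Icc_self (branch_mem hθ hy.1 k)
  have hw := branchWeight_nonneg hθ hx.1 k
  have h1 := hg _ hux _ huy
  have h2 := hg _ huy 0 ⟨le_rfl, hθ.le⟩
  rw [sub_zero (branch θ k y), abs_of_nonneg huy.1] at h2
  have h3 := abs_branch_sub_le hθ hθ2 hx.1 hy.1 k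
  have h4 := abs_branchWeight_sub_mul_le hθ hθ2 hx.1 hy.1 k
  rw [Real.norm_eq_abs]
  calc _ = |branchWeight θ k x * (g (branch θ k x) - g (branch θ k y))
        + (branchWeight θ k x - branchWeight θ k y) * (g (branch θ k y) - g 0)| := by
        congr 1; ring
    _ ≤ branchWeight θ k x * |g (branch θ k x) - g (branch θ k y)|
        + |branchWeight θ k x - branchWeight θ k y| * |g (branch θ k y) - g 0| := by
        refine (abs_add_le _ _).trans ?_
        rw [abs_mul, abs_mul, abs_of_nonneg hw]
    _ ≤ branchWeight θ k x * (L * (1 / 2 * |x - y|))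
        + |branchWeight θ k x - branchWeight θ k y| * (L * branch θ k y) := by
        gcongr
        exact h1.trans (mul_le_mul_of_nonneg_left h3 hL)
    _ ≤ branchWeight θ k x * (L * (1 / 2 * |x - y|))
        + L * (1 / 3 * branchWeight θ k x * |x - y|) := by
        have := mul_le_mul_of_nonneg_left h4 hL
        linarith
    _ = _ := by ring

theorem transfer_nonneg {θ : ℝ} {g : ℝ → ℝ} (hθ : 0 < θ) (hg : ∀ x ∈ Set.Icc 0 θ, 0 ≤ g x) :
    ∀ x ∈ Set.Icc 0 θ, 0 ≤ transfer θ g x := fun _ hx =>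
  tsum_nonneg fun k => mul_nonneg (branchWeight_nonneg hθ hx.1 k)
    (hg _ (Set.Ioc_subset_Icc_self (branch_mem hθ hx.1 k)))

/-! ### Pushforward under `T θ` -/

theorem measurable_T (θ : ℝ) : Measurable (T θ) := by
  unfold T
  refine Measurable.ite (measurableSet_singleton 0) measurable_const ?_
  have : Measurable fun x : ℝ => (⌊1 / (x * θ)⌋ : ℝ) :=
    (measurable_of_countable (fun n : ℤ => (n : ℝ))).comp
      (Int.measurable_floor.comp (by fun_prop))
  fun_prop

/-- Integrality of `1/θ²` makes the digit of `branch θ k t` equal to `m + k`. The endpoint `t = θ`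
is excluded because there the digit jumps by one. -/
theorem T_branch {θ t : ℝ} (hθ : 0 < θ) {m : ℕ} (hm : θ ^ 2 * m = 1) (ht : t ∈ Set.Ico 0 θ)
    (k : ℕ) : T θ (branch θ k t) = t := by
  have hu := (branch_mem hθ ht.1 k).1
  have hm' : 1 / θ = θ * m := by field_simp; linarith
  have h1 : 1 / branch θ k t = θ * m + t + θ * k := by rw [branch, one_div, inv_inv, hm']
  have hfl : ⌊1 / (branch θ k t * θ)⌋ = (m : ℤ) + k := by
    rw [← div_div, h1, Int.floor_eq_iff]
    push_cast
    constructor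
    · rw [le_div_iff₀ hθ]; linarith [ht.1]
    · rw [div_lt_iff₀ hθ]; linarith [ht.2]
  rw [T, if_neg hu.ne', hfl, h1]
  push_cast
  ring

theorem exists_branch_T {θ y : ℝ} (hθ : 0 < θ) {m : ℕ} (hm : θ ^ 2 * m = 1)
    (hy : y ∈ Set.Ioc 0 θ) : T θ y ∈ Set.Ico 0 θ ∧ ∃ k, branch θ k (T θ y) = y := by
  have hm' : 1 / θ = θ * m := by field_simp; linarith
  have hT : T θ y = 1 / y - θ * (⌊1 / (y * θ)⌋ : ℝ) := by rw [T, if_neg hy.1.ne']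
  have h1 : 1 / y = θ * (1 / (y * θ)) := by field_simp
  have h2 := Int.floor_le (1 / (y * θ))
  have h3 := Int.lt_floor_add_one (1 / (y * θ))
  have hfl : (m : ℤ) ≤ ⌊1 / (y * θ)⌋ := by
    rw [Int.le_floor, le_div_iff₀ (mul_pos hy.1 hθ)]
    push_cast
    calc (m : ℝ) * (y * θ) ≤ m * (θ * θ) := by gcongr; exact hy.2
      _ = 1 := by linarith
  refine ⟨⟨by rw [hT]; nlinarith, by rw [hT]; nlinarith⟩, (⌊1 / (y * θ)⌋ - m).toNat, ?_⟩
  have hc : (((⌊1 / (y * θ)⌋ - m).toNat : ℕ) : ℝ) = (⌊1 / (y * θ)⌋ : ℝ) - m := by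
    rw [← Int.cast_natCast, Int.toNat_of_nonneg (by omega)]; push_cast; rfl
  rw [branch, hc, hT, hm', inv_eq_iff_eq_inv, ← one_div y]
  ring

theorem preimage_T_inter {θ : ℝ} (hθ : 0 < θ) {m : ℕ} (hm : θ ^ 2 * m = 1) (B : Set ℝ) :
    T θ ⁻¹' B ∩ Set.Ioc 0 θ = ⋃ k, branch θ k '' (B ∩ Set.Ico 0 θ) := by
  ext y
  simp only [Set.mem_inter_iff, Set.mem_preimage, Set.mem_iUnion, Set.mem_image]
  constructor
  · rintro ⟨hB, hy⟩
    obtain ⟨h1, k, hk⟩ := exists_branch_T hθ hm hy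
    exact ⟨k, _, ⟨hB, h1⟩, hk⟩
  · rintro ⟨k, t, ⟨hB, ht⟩, rfl⟩
    rw [T_branch hθ hm ht]
    exact ⟨hB, branch_mem hθ ht.1 k⟩

theorem hasDerivAt_branch {θ x : ℝ} (hθ : 0 < θ) (hx : 0 ≤ x) (k : ℕ) :
    HasDerivAt (branch θ k) (-(branch θ k x) ^ 2) x := by
  have h : HasDerivAt (fun x : ℝ => 1 / θ + x + θ * k) 1 x :=
    ((hasDerivAt_id x).const_add _).add_const _
  have e : -(branch θ k x) ^ 2 = -1 / (1 / θ + x + θ * k) ^ 2 := by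
    rw [branch, inv_pow]; ring
  rw [e]
  exact h.inv (by positivity)

theorem disjoint_image_branch {θ : ℝ} (hθ : 0 < θ) {m : ℕ} (hm : θ ^ 2 * m = 1) (B : Set ℝ) :
    Pairwise (Function.onFun Disjoint fun k => branch θ k '' (B ∩ Set.Ico 0 θ)) := by
  intro j k hjk
  rw [Function.onFun, Set.disjoint_left]
  rintro _ ⟨t, ht, rfl⟩ ⟨s, hs, hst⟩
  have hts : s = t := by
    rw [← T_branch hθ hm hs.2 k, hst, T_branch hθ hm ht.2 j]
  subst hts
  apply hjk
  simp only [branch] at hst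
  rw [inv_inj, add_right_inj, mul_right_inj' hθ.ne'] at hst
  exact_mod_cast hst.symm

theorem invDensity_pos {θ x : ℝ} (hθ : 0 < θ) (hx : 0 ≤ x) : 0 < invDensity θ x := by
  unfold invDensity; positivity

/-- This identity dictates the form of `branchWeight`: the left side is the Jacobian of the branch
times the invariant density at the image point. -/
theorem sq_mul_invDensity_branch {θ x : ℝ} (hθ : 0 < θ) (hx : 0 ≤ x) (k : ℕ) :
    branch θ k x ^ 2 * invDensity θ (branch θ k x) = branchWeight θ k x * invDensity θ x := by
  have h1 : 1 + θ * x = θ * (1 / θ + x) := by field_simp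
  unfold branchWeight invDensity
  rw [h1]
  unfold branch
  have hX : 0 < 1 / θ + x := by positivity
  generalize 1 / θ + x = X at *
  have h2 : 0 < X + θ * k := by positivity
  rw [show X + θ * ((k : ℝ) + 1) = X + θ * k + θ by ring]
  generalize X + θ * k = A at *
  have h3 : 1 + θ * A⁻¹ = (A + θ) / A := by field_simp
  rw [h3]
  field_simp

theorem continuousOn_of_lipschitz {θ L : ℝ} {g : ℝ → ℝ} (hL : 0 ≤ L)
    (hg : ∀ x ∈ Set.Icc 0 θ, ∀ y ∈ Set.Icc 0 θ, |g x - g y| ≤ L * |x - y|) :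
    ContinuousOn g (Set.Icc 0 θ) :=
  (LipschitzOnWith.of_dist_le_mul (K := L.toNNReal) fun x hx y hy => by
    rw [Real.coe_toNNReal _ hL]; exact hg x hx y hy).continuousOn

theorem map_T_densMeasure {θ L : ℝ} {g : ℝ → ℝ} (hθ : 0 < θ) {m : ℕ} (hm : θ ^ 2 * m = 1)
    (hL : 0 ≤ L) (hg0 : ∀ x ∈ Set.Icc 0 θ, 0 ≤ g x)
    (hg : ∀ x ∈ Set.Icc 0 θ, ∀ y ∈ Set.Icc 0 θ, |g x - g y| ≤ L * |x - y|) :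
    (densMeasure θ g).map (T θ) = densMeasure θ (transfer θ g) := by
  ext B hB
  have hTB := measurable_T θ hB
  have hcont := continuousOn_of_lipschitz hL hg
  have hBs : MeasurableSet (B ∩ Set.Ico 0 θ) := hB.inter measurableSet_Ico
  -- Endpoints are null, so the source becomes `(0, θ]` and the target `[0, θ)`, between which the
  -- branches are exact inverses.
  rw [Measure.map_apply (measurable_T θ) hB, densMeasure, densMeasure, withDensity_apply _ hTB,
    withDensity_apply _ hB, ← Measure.restrict_congr_set Ioc_ae_eq_Icc,
    Measure.restrict_restrict hTB, preimage_T_inter hθ hm,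
    Measure.restrict_congr_set Ioc_ae_eq_Icc, ← Measure.restrict_congr_set Ico_ae_eq_Icc,
    Measure.restrict_restrict hB]
  have hinj : ∀ k, Set.InjOn (branch θ k) (B ∩ Set.Ico 0 θ) := fun k s hs t ht hst => by
    rw [← T_branch hθ hm hs.2 k, hst, T_branch hθ hm ht.2 k]
  have hder : ∀ k, ∀ x ∈ B ∩ Set.Ico 0 θ,
      HasDerivWithinAt (branch θ k) (-(branch θ k x) ^ 2) (B ∩ Set.Ico 0 θ) x := fun k x hx =>
    (hasDerivAt_branch hθ hx.2.1 k).hasDerivWithinAt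
  have hbc : ∀ k, ContinuousOn (branch θ k) (B ∩ Set.Ico 0 θ) := fun k x hx =>
    (hder k x hx).continuousWithinAt
  rw [lintegral_iUnion (fun k => measurable_image_of_fderivWithin hBs
    (fun x hx => (hder k x hx).hasFDerivWithinAt) (hinj k)) (disjoint_image_branch hθ hm B)]
  have hterm : ∀ k, ∫⁻ a in branch θ k '' (B ∩ Set.Ico 0 θ), ENNReal.ofReal (g a * invDensity θ a)
      = ∫⁻ x in B ∩ Set.Ico 0 θ,
        ENNReal.ofReal (branchWeight θ k x * g (branch θ k x) * invDensity θ x) := fun k => by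
    rw [lintegral_image_eq_lintegral_abs_deriv_mul hBs (hder k) (hinj k)]
    refine setLIntegral_congr_fun hBs fun x hx => ?_
    rw [← ENNReal.ofReal_mul (abs_nonneg _), abs_neg, abs_of_nonneg (sq_nonneg _)]
    congr 1
    linear_combination g (branch θ k x) * sq_mul_invDensity_branch hθ hx.2.1 k
  simp_rw [hterm]
  rw [← lintegral_tsum]
  · refine setLIntegral_congr_fun hBs fun x hx => ?_
    rw [transfer, ← tsum_mul_right, ENNReal.ofReal_tsum_of_nonneg]
    · intro k
      exact mul_nonneg (mul_nonneg (branchWeight_nonneg hθ hx.2.1 k)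
        (hg0 _ (Set.Ioc_subset_Icc_self (branch_mem hθ hx.2.1 k)))) (invDensity_pos hθ hx.2.1).le
    · exact (summable_transfer hθ hL hg hx.2.1).mul_right _
  · intro k
    have h1 : ContinuousOn (fun x => g (branch θ k x)) (B ∩ Set.Ico 0 θ) :=
      hcont.comp (hbc k) fun x hx => Set.Ioc_subset_Icc_self (branch_mem hθ hx.2.1 k)
    have h2 : Measurable fun x => branchWeight θ k x := by unfold branchWeight; fun_prop
    have h3 : Measurable fun x => invDensity θ x := by unfold invDensity; fun_prop
    exact ((h2.aemeasurable.mul (h1.aemeasurable hBs)).mul h3.aemeasurable).ennreal_ofReal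

/-- Iterating `map_T_densMeasure`. -/
theorem exists_map_iterate_densMeasure {θ L : ℝ} {g : ℝ → ℝ} (hθ : 0 < θ) (hθ2 : θ ^ 2 ≤ 1 / 2)
    {m : ℕ} (hm : θ ^ 2 * m = 1) (hL : 0 ≤ L) (hg0 : ∀ x ∈ Set.Icc 0 θ, 0 ≤ g x)
    (hg : ∀ x ∈ Set.Icc 0 θ, ∀ y ∈ Set.Icc 0 θ, |g x - g y| ≤ L * |x - y|) (n : ℕ) :
    ∃ f : ℝ → ℝ, (densMeasure θ g).map (T θ)^[n] = densMeasure θ f ∧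
      (∀ x ∈ Set.Icc 0 θ, 0 ≤ f x) ∧
      ∀ x ∈ Set.Icc 0 θ, ∀ y ∈ Set.Icc 0 θ, |f x - f y| ≤ L * (5 / 6) ^ n * |x - y| := by
  induction n with
  | zero => exact ⟨g, by simp, hg0, by simpa using hg⟩
  | succ n ih =>
    obtain ⟨f, hf, hf0, hfL⟩ := ih
    have hLn : 0 ≤ L * (5 / 6) ^ n := by positivity
    refine ⟨transfer θ f, ?_, transfer_nonneg hθ hf0, ?_⟩
    · rw [Function.iterate_succ', ← Measure.map_map (measurable_T θ) ((measurable_T θ).iterate n),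
        hf, map_T_densMeasure hθ hm hLn hf0 hfL]
    · intro x hx y hy
      have := abs_transfer_sub_le hθ hθ2 hLn hfL x hx y hy
      rw [pow_succ]
      linarith


/-! ### Distribution functions and exponential convergence -/

theorem measureReal_withDensity_ofReal {α : Type*} [MeasurableSpace α] {ν : Measure α} {f : α → ℝ}
    (hf : AEStronglyMeasurable f ν) (h0 : 0 ≤ᵐ[ν] f) {A : Set α} (hA : MeasurableSet A) :
    (ν.withDensity fun x => ENNReal.ofReal (f x)).real A = ∫ x in A, f x ∂ν := by
  rw [measureReal_def, withDensity_apply _ hA,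
    integral_eq_lintegral_of_nonneg_ae (ae_restrict_of_ae h0) hf.restrict]

theorem continuousOn_invDensity {θ : ℝ} (hθ : 0 < θ) :
    ContinuousOn (invDensity θ) (Set.Icc 0 θ) := by
  unfold invDensity
  refine continuousOn_const.div (by fun_prop) fun x hx => ?_
  have := mul_nonneg hθ.le hx.1
  positivity

theorem integral_invDensity {θ x : ℝ} (hθ : 0 < θ) (hx : 0 ≤ x) :
    ∫ t in 0..x, invDensity θ t = Real.log (1 + θ * x) := by
  have hpos : ∀ t ∈ Set.uIcc 0 x, 0 < 1 + θ * t := fun t ht => by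
    rw [Set.uIcc_of_le hx] at ht
    have := mul_nonneg hθ.le ht.1
    positivity
  have hd : ∀ t ∈ Set.uIcc 0 x,
      HasDerivAt (fun t => Real.log (1 + θ * t)) (invDensity θ t) t := fun t ht => by
    have h : HasDerivAt (fun t : ℝ => 1 + θ * t) θ t := by
      simpa using ((hasDerivAt_id t).const_mul θ).const_add 1
    exact h.log (hpos t ht).ne'
  rw [intervalIntegral.integral_eq_sub_of_hasDerivAt hd]
  · simp
  · refine ContinuousOn.intervalIntegrable ?_
    unfold invDensity
    exact continuousOn_const.div (by fun_prop) fun t ht => (hpos t ht).ne'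

/-- The mass that a measure with nonnegative continuous density gives to `(-∞, x)`. -/
theorem densMeasure_real_Iio {θ x : ℝ} {f : ℝ → ℝ} (hθ : 0 < θ)
    (hf : ContinuousOn f (Set.Icc 0 θ)) (hf0 : ∀ x ∈ Set.Icc 0 θ, 0 ≤ f x)
    (hx : x ∈ Set.Icc 0 θ) :
    (densMeasure θ f).real (Set.Iio x) = ∫ t in 0..x, f t * invDensity θ t := by
  have hset : Set.Iio x ∩ Set.Icc 0 θ = Set.Ico 0 x := by
    ext t
    simp only [Set.mem_inter_iff, Set.mem_Iio, Set.mem_Icc, Set.mem_Ico]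
    have := hx.2
    constructor
    · rintro ⟨h1, h2, -⟩; exact ⟨h2, h1⟩
    · rintro ⟨h1, h2⟩; exact ⟨h2, h1, by linarith⟩
  rw [densMeasure, measureReal_withDensity_ofReal (f := fun t => f t * invDensity θ t)
    ((hf.mul (continuousOn_invDensity hθ)).aestronglyMeasurable measurableSet_Icc)
    ((ae_restrict_iff' measurableSet_Icc).2 (ae_of_all _ fun t ht =>
      mul_nonneg (hf0 t ht) (invDensity_pos hθ ht.1).le)) measurableSet_Iio,
    Measure.restrict_restrict measurableSet_Iio, hset, intervalIntegral.integral_of_le hx.1,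
    integral_Ico_eq_integral_Ioc]

theorem densMeasure_real_univ {θ : ℝ} {f : ℝ → ℝ} (hθ : 0 < θ)
    (hf : ContinuousOn f (Set.Icc 0 θ)) (hf0 : ∀ x ∈ Set.Icc 0 θ, 0 ≤ f x) :
    (densMeasure θ f).real Set.univ = ∫ t in 0..θ, f t * invDensity θ t := by
  rw [densMeasure, measureReal_withDensity_ofReal (f := fun t => f t * invDensity θ t)
    ((hf.mul (continuousOn_invDensity hθ)).aestronglyMeasurable measurableSet_Icc)
    ((ae_restrict_iff' measurableSet_Icc).2 (ae_of_all _ fun t ht =>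
      mul_nonneg (hf0 t ht) (invDensity_pos hθ ht.1).le)) MeasurableSet.univ,
    Measure.restrict_univ, intervalIntegral.integral_of_le hθ.le, integral_Icc_eq_integral_Ioc]

/-- Replace `f t` by `f 0` under the integral. The error keeps the factor `log (1 + θ * x)`, which
vanishes at `x = 0`; this makes the multiplicative form of the error term possible. -/
theorem abs_integral_mul_invDensity_sub_le {θ D x : ℝ} {f : ℝ → ℝ} (hθ : 0 < θ) (hD : 0 ≤ D)
    (hf : ∀ x ∈ Set.Icc 0 θ, ∀ y ∈ Set.Icc 0 θ, |f x - f y| ≤ D * |x - y|)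
    (hx : x ∈ Set.Icc 0 θ) :
    |(∫ t in 0..x, f t * invDensity θ t) - f 0 * Real.log (1 + θ * x)|
      ≤ D * θ * Real.log (1 + θ * x) := by
  have hsub : Set.uIcc 0 x ⊆ Set.Icc 0 θ := by
    rw [Set.uIcc_of_le hx.1]; exact Set.Icc_subset_Icc_right hx.2
  have hr := (continuousOn_invDensity hθ).mono hsub
  have hri : IntervalIntegrable (invDensity θ) volume 0 x := hr.intervalIntegrable
  have hfi : IntervalIntegrable (fun t => f t * invDensity θ t) volume 0 x :=
    (((continuousOn_of_lipschitz hD hf).mono hsub).mul hr).intervalIntegrable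
  rw [← integral_invDensity hθ hx.1, ← intervalIntegral.integral_const_mul,
    ← intervalIntegral.integral_sub hfi (hri.const_mul _), ← intervalIntegral.integral_const_mul,
    ← Real.norm_eq_abs]
  refine intervalIntegral.norm_integral_le_of_norm_le hx.1 (ae_of_all _ fun t ht => ?_)
    (hri.const_mul _)
  have ht' : t ∈ Set.Icc 0 θ := ⟨ht.1.le, ht.2.trans hx.2⟩
  have hrt := (invDensity_pos hθ ht'.1).le
  rw [← sub_mul, norm_mul, Real.norm_eq_abs, Real.norm_of_nonneg hrt]
  refine mul_le_mul_of_nonneg_right ((hf t ht' 0 ⟨le_rfl, hθ.le⟩).trans ?_) hrt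
  rw [sub_zero, abs_of_nonneg ht'.1]
  exact mul_le_mul_of_nonneg_left ht'.2 hD

theorem log_one_add_mul_nonneg {θ x : ℝ} (hθ : 0 < θ) (hx : 0 ≤ x) :
    0 ≤ Real.log (1 + θ * x) :=
  Real.log_nonneg (by nlinarith)

theorem log_one_add_sq_pos {θ : ℝ} (hθ : 0 < θ) : 0 < Real.log (1 + θ * θ) :=
  Real.log_pos (by nlinarith)

/-- Exponential convergence for densities that are Lipschitz relative to `invDensity θ`. -/
theorem exists_abs_map_iterate_real_sub_le {θ L : ℝ} {g : ℝ → ℝ} (hθ : 0 < θ)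
    (hθ2 : θ ^ 2 ≤ 1 / 2) {m : ℕ} (hm : θ ^ 2 * m = 1) (hL : 0 ≤ L)
    (hg0 : ∀ x ∈ Set.Icc 0 θ, 0 ≤ g x)
    (hg : ∀ x ∈ Set.Icc 0 θ, ∀ y ∈ Set.Icc 0 θ, |g x - g y| ≤ L * |x - y|) (n : ℕ)
    {x : ℝ} (hx : x ∈ Set.Icc 0 θ) :
    |((densMeasure θ g).map (T θ)^[n]).real (Set.Iio x)
        - (densMeasure θ g).real Set.univ / Real.log (1 + θ * θ) * Real.log (1 + θ * x)|
      ≤ 2 * L * θ * (5 / 6) ^ n * Real.log (1 + θ * x) := by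
  obtain ⟨f, hf, hf0, hfL⟩ := exists_map_iterate_densMeasure hθ hθ2 hm hL hg0 hg n
  have hD : 0 ≤ L * (5 / 6) ^ n := by positivity
  have hfc := continuousOn_of_lipschitz hD hfL
  have huniv : (densMeasure θ g).real Set.univ = (densMeasure θ f).real Set.univ := by
    rw [← hf, map_measureReal_apply ((measurable_T θ).iterate n) MeasurableSet.univ,
      Set.preimage_univ]
  rw [huniv, hf, densMeasure_real_Iio hθ hfc hf0 hx, densMeasure_real_univ hθ hfc hf0]
  have h1 := abs_integral_mul_invDensity_sub_le hθ hD hfL hx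
  have h2 := abs_integral_mul_invDensity_sub_le hθ hD hfL (x := θ) ⟨hθ.le, le_rfl⟩
  have hF := log_one_add_mul_nonneg hθ hx.1
  have hLg := log_one_add_sq_pos hθ
  generalize (∫ t in 0..x, f t * invDensity θ t) = I at *
  generalize (∫ t in 0..θ, f t * invDensity θ t) = J at *
  generalize Real.log (1 + θ * θ) = G at *
  generalize Real.log (1 + θ * x) = F at *
  -- The estimate at `x = θ`, divided by `G`: conserved total mass determines `f 0` up to the same
  -- error.
  have h3 : |J / G - f 0| ≤ L * (5 / 6) ^ n * θ := by
    rw [div_sub' hLg.ne', abs_div, abs_of_pos hLg, div_le_iff₀ hLg, mul_comm G]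
    exact h2
  have h4 : |(f 0 - J / G) * F| ≤ L * (5 / 6) ^ n * θ * F := by
    rw [abs_mul, abs_of_nonneg hF, abs_sub_comm]
    exact mul_le_mul_of_nonneg_right h3 hF
  calc |I - J / G * F| = |(I - f 0 * F) + (f 0 - J / G) * F| := by congr 1; ring
    _ ≤ _ := (abs_add_le _ _).trans (add_le_add h1 h4)
    _ = _ := by ring

/-! ### Densities relative to `invDensity θ` and `L¹` approximation -/

theorem distrib_eq {θ : ℝ} {μ : Measure ℝ} {h : ℝ → ℝ} (hμ : IsDensity θ μ h) (n : ℕ) (x : ℝ) :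
    distrib θ μ n x = (μ.map (T θ)^[n]).real (Set.Iio x) := by
  rw [map_measureReal_apply ((measurable_T θ).iterate n) measurableSet_Iio, distrib]
  refine measureReal_congr ?_
  have hae : ∀ᵐ y ∂μ, y ∈ Set.Icc 0 θ := by
    rw [hμ.eq_withDensity]
    exact (withDensity_absolutelyContinuous _ _).ae_le (ae_restrict_mem measurableSet_Icc)
  filter_upwards [hae] with y hy
  exact propext ⟨fun h => h.2, fun h => ⟨hy, h⟩⟩

theorem withDensity_eq_densMeasure {θ : ℝ} (hθ : 0 < θ) (h : ℝ → ℝ) :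
    ((volume.restrict (Set.Icc 0 θ)).withDensity fun x => ENNReal.ofReal (h x))
      = densMeasure θ fun x => h x / invDensity θ x := by
  refine withDensity_congr_ae ((ae_restrict_iff' measurableSet_Icc).2 (ae_of_all _ fun x hx => ?_))
  simp only
  rw [div_mul_cancel₀ _ (invDensity_pos hθ hx.1).ne']

theorem exists_lipschitz_div_invDensity {θ C : ℝ} {h : ℝ → ℝ} (hθ : 0 < θ) (hC : 0 ≤ C)
    (hh : ∀ x ∈ Set.Icc 0 θ, ∀ y ∈ Set.Icc 0 θ, |h x - h y| ≤ C * |x - y|) :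
    ∃ L : ℝ, 0 ≤ L ∧ ∀ x ∈ Set.Icc 0 θ, ∀ y ∈ Set.Icc 0 θ,
      |h x / invDensity θ x - h y / invDensity θ y| ≤ L * |x - y| := by
  refine ⟨(C * (1 + θ * θ) + (|h 0| + C * θ) * θ) / θ, by positivity, fun x hx y hy => ?_⟩
  have h1 := hh x hx y hy
  have h2 := abs_le_of_lipschitz hθ hC hh y hy
  have hx1 : 0 ≤ 1 + θ * x := by have := mul_nonneg hθ.le hx.1; positivity
  have heq : h x / invDensity θ x - h y / invDensity θ y
      = ((h x - h y) * (1 + θ * x) + h y * (θ * (x - y))) / θ := by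
    simp only [invDensity, div_div_eq_mul_div]; ring
  rw [heq, abs_div, abs_of_pos hθ, div_mul_eq_mul_div, div_le_div_iff_of_pos_right hθ, add_mul]
  refine (abs_add_le _ _).trans (add_le_add ?_ ?_)
  · rw [abs_mul, abs_of_nonneg hx1, mul_right_comm]
    have : 1 + θ * x ≤ 1 + θ * θ := by have := hx.2; gcongr
    gcongr
  · rw [abs_mul, abs_mul, abs_of_pos hθ, ← mul_assoc]
    gcongr

/-- A finite measure with a density is approximated, uniformly on measurable sets, by measures
whose density is Lipschitz relative to `invDensity θ`. -/
theorem exists_densMeasure_near {θ : ℝ} (hθ : 0 < θ) {μ : Measure ℝ} [IsFiniteMeasure μ]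
    {h : ℝ → ℝ} (hμ : IsDensity θ μ h) {ε : ℝ} (hε : 0 < ε) :
    ∃ (g : ℝ → ℝ) (L : ℝ), 0 ≤ L ∧ (∀ x ∈ Set.Icc 0 θ, 0 ≤ g x) ∧
      (∀ x ∈ Set.Icc 0 θ, ∀ y ∈ Set.Icc 0 θ, |g x - g y| ≤ L * |x - y|) ∧
      ∀ A, MeasurableSet A → |μ.real A - (densMeasure θ g).real A| ≤ ε := by
  have hnn : 0 ≤ᵐ[volume.restrict (Set.Icc 0 θ)] h :=
    (ae_restrict_iff' measurableSet_Icc).2 (ae_of_all _ hμ.nonneg)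
  have hint : Integrable h (volume.restrict (Set.Icc 0 θ)) := by
    refine ⟨hμ.aemeasurable.aestronglyMeasurable, ?_⟩
    rw [hasFiniteIntegral_iff_ofReal hnn, ← setLIntegral_univ,
      ← withDensity_apply _ MeasurableSet.univ, ← hμ.eq_withDensity]
    exact measure_lt_top _ _
  obtain ⟨φ, -, hφ, hφc, hφi⟩ := hint.exists_hasCompactSupport_integral_sub_le (half_pos hε)
  -- Uniform error `ε / (2θ)` on an interval of length `θ` costs `ε / 2` in `L¹`. Truncating `p` at
  -- 0 keeps it Lipschitz and, as `h ≥ 0`, does not increase its distance to `h`.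
  obtain ⟨p, hp⟩ := exists_polynomial_near_of_continuousOn 0 θ φ hφc.continuousOn
    (ε / (2 * θ)) (by positivity)
  obtain ⟨C, hC⟩ := LocallyLipschitzOn.exists_lipschitzOnWith_of_compact
    (s := Set.Icc 0 θ) isCompact_Icc
    (ContDiff.locallyLipschitz (𝕂 := ℝ) (f := fun x => p.eval x)
      (by simpa using p.contDiff_aeval (𝕜 := ℝ) (R := ℝ) 1)).locallyLipschitzOn
  have hlip : ∀ x ∈ Set.Icc 0 θ, ∀ y ∈ Set.Icc 0 θ,
      |max (p.eval x) 0 - max (p.eval y) 0| ≤ C * |x - y| := fun x hx y hy =>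
    (abs_max_sub_max_le_abs _ _ _).trans (hC.dist_le_mul x hx y hy)
  obtain ⟨L, hL, hgL⟩ := exists_lipschitz_div_invDensity hθ C.2 hlip
  refine ⟨_, L, hL, fun x hx => div_nonneg (le_max_right _ _) (invDensity_pos hθ hx.1).le, hgL,
    fun A hA => ?_⟩
  have hpi : Integrable (fun x => max (p.eval x) 0) (volume.restrict (Set.Icc 0 θ)) :=
    (p.continuous.max continuous_const).continuousOn.integrableOn_compact isCompact_Icc
  rw [← withDensity_eq_densMeasure hθ, hμ.eq_withDensity,
    measureReal_withDensity_ofReal hint.1 hnn hA,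
    measureReal_withDensity_ofReal hpi.1 (ae_of_all _ fun _ => le_max_right _ _) hA,
    ← integral_sub hint.integrableOn hpi.integrableOn, ← Real.norm_eq_abs]
  have hbound : ∫ x in Set.Icc 0 θ, ‖φ x - p.eval x‖ ≤ ε / 2 := by
    calc _ ≤ ∫ _ in Set.Icc 0 θ, ε / (2 * θ) := by
          refine setIntegral_mono_on (hφi.sub ?_).norm (by simp) measurableSet_Icc fun x hx => ?_
          · exact p.continuous.continuousOn.integrableOn_compact isCompact_Icc
          · rw [← norm_neg, neg_sub]; exact (hp x hx).le
      _ = ε / 2 := by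
          rw [setIntegral_const, Real.volume_real_Icc_of_le hθ.le, smul_eq_mul]
          field_simp
          ring
  have hpi' : Integrable (fun x => p.eval x) (volume.restrict (Set.Icc 0 θ)) :=
    p.continuous.continuousOn.integrableOn_compact isCompact_Icc
  calc _ ≤ ∫ x in A, ‖h x - max (p.eval x) 0‖ ∂(volume.restrict (Set.Icc 0 θ)) :=
        norm_integral_le_integral_norm _
    _ ≤ ∫ x in Set.Icc 0 θ, ‖h x - max (p.eval x) 0‖ :=
        setIntegral_le_integral (hint.sub hpi).norm (ae_of_all _ fun _ => norm_nonneg _)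
    _ ≤ ∫ x in Set.Icc 0 θ, (‖h x - φ x‖ + ‖φ x - p.eval x‖) := by
        refine setIntegral_mono_on (hint.sub hpi).norm
          ((hint.sub hφi).norm.add (hφi.sub hpi').norm) measurableSet_Icc fun x hx => ?_
        have h1 := abs_max_sub_max_le_abs (h x) (p.eval x) 0
        rw [max_eq_left (hμ.nonneg x hx)] at h1
        exact h1.trans (abs_sub_le _ _ _)
    _ ≤ ε := by
        refine (integral_add (hint.sub hφi).norm (hφi.sub hpi').norm).trans_le ?_
        simp only [Pi.sub_apply]
        linarith

theorem tendsto_distrib {θ : ℝ} (hθ : 0 < θ) (hθ2 : θ ^ 2 ≤ 1 / 2) {m : ℕ} (hm : θ ^ 2 * m = 1)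
    {μ : Measure ℝ} [IsProbabilityMeasure μ] {h : ℝ → ℝ} (hμ : IsDensity θ μ h)
    {x : ℝ} (hx : x ∈ Set.Icc 0 θ) :
    Tendsto (fun n => distrib θ μ n x) atTop
      (𝓝 (1 / Real.log (1 + θ * θ) * Real.log (1 + θ * x))) := by
  rw [Metric.tendsto_atTop]
  intro ε hε
  obtain ⟨g, L, hL, hg0, hgL, hnear⟩ := exists_densMeasure_near hθ hμ (ε := ε / 4) (by positivity)
  have hlim : Tendsto (fun n : ℕ => 2 * L * θ * (5 / 6 : ℝ) ^ n * Real.log (1 + θ * x)) atTop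
      (𝓝 0) := by
    simpa using ((tendsto_pow_atTop_nhds_zero_of_lt_one (r := (5 / 6 : ℝ)) (by norm_num)
      (by norm_num)).const_mul (2 * L * θ)).mul_const (Real.log (1 + θ * x))
  obtain ⟨N, hN⟩ := eventually_atTop.1 (hlim.eventually_lt_const (half_pos hε))
  refine ⟨N, fun n hn => ?_⟩
  have h1 := exists_abs_map_iterate_real_sub_le hθ hθ2 hm hL hg0 hgL n hx
  have h2 := hnear _ ((measurable_T θ).iterate n (measurableSet_Iio (a := x)))
  have h3 := hnear _ MeasurableSet.univ
  have h4 := hN n hn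
  rw [map_measureReal_apply ((measurable_T θ).iterate n) measurableSet_Iio] at h1
  rw [distrib_eq hμ, map_measureReal_apply ((measurable_T θ).iterate n) measurableSet_Iio,
    Real.dist_eq]
  rw [probReal_univ] at h3
  have hG := log_one_add_sq_pos hθ
  have hF := log_one_add_mul_nonneg hθ hx.1
  have hFG : Real.log (1 + θ * x) ≤ Real.log (1 + θ * θ) := by
    have := mul_nonneg hθ.le hx.1
    exact Real.log_le_log (by positivity) (by have := hx.2; gcongr)
  generalize μ.real _ = a at *
  generalize (densMeasure θ g).real Set.univ = M at *
  generalize (densMeasure θ g).real _ = b at *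
  generalize 2 * L * θ * (5 / 6) ^ n * Real.log (1 + θ * x) = δ at *
  generalize Real.log (1 + θ * x) = F at *
  generalize Real.log (1 + θ * θ) = G at *
  have h5 : |(M - 1) / G * F| ≤ ε / 4 := by
    rw [div_mul_eq_mul_div, mul_div_assoc, abs_mul, abs_sub_comm, abs_of_nonneg (div_nonneg hF hG.le)]
    calc _ ≤ |1 - M| * 1 := by gcongr; exact div_le_one_of_le₀ hFG hG.le
      _ ≤ _ := by rwa [mul_one]
  -- The approximant need not have mass 1. The three errors are approximation (`ε/4`), convergence
  -- for the approximant (below `ε/2`), and mass defect (`ε/4`).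
  have h6 : a - 1 / G * F = (a - b) + (b - M / G * F) + (M - 1) / G * F := by ring
  rw [h6]
  have := abs_add_three (a - b) (b - M / G * F) ((M - 1) / G * F)
  linarith

/-! ### The limit measure and the final assembly -/

theorem gammaMeasure_real_Icc {θ x : ℝ} (hθ : 0 < θ) (hx : x ∈ Set.Icc 0 θ) :
    (gammaMeasure θ).real (Set.Icc 0 x) = 1 / Real.log (1 + θ * θ) * Real.log (1 + θ * x) := by
  have hG := log_one_add_sq_pos hθ
  rw [← sq] at hG ⊢
  rw [gammaMeasure, measureReal_withDensity_ofReal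
    (f := fun t => 1 / Real.log (1 + θ ^ 2) * (θ / (1 + θ * t)))
    ((continuousOn_const.mul (continuousOn_invDensity hθ)).aestronglyMeasurable measurableSet_Icc)
    ((ae_restrict_iff' measurableSet_Icc).2 (ae_of_all _ fun t ht =>
      mul_nonneg (by positivity) (invDensity_pos hθ ht.1).le)) measurableSet_Icc,
    Measure.restrict_restrict measurableSet_Icc,
    Set.inter_eq_left.2 (Set.Icc_subset_Icc_right hx.2), integral_const_mul,
    integral_Icc_eq_integral_Ioc, ← intervalIntegral.integral_of_le hx.1,
    ← integral_invDensity hθ hx.1]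
  rfl

theorem exists_abs_distrib_sub_le {θ : ℝ} (hθ : 0 < θ) (hθ2 : θ ^ 2 ≤ 1 / 2) {m : ℕ}
    (hm : θ ^ 2 * m = 1) {μ : Measure ℝ} [IsProbabilityMeasure μ] (hμ : HasLipschitzDensity θ μ) :
    ∃ K : ℝ, 0 ≤ K ∧ ∀ n : ℕ, ∀ x ∈ Set.Icc 0 θ,
      |distrib θ μ n x - 1 / Real.log (1 + θ * θ) * Real.log (1 + θ * x)|
        ≤ K * (5 / 6) ^ n * Real.log (1 + θ * x) := by
  obtain ⟨h, hd, C, hC⟩ := hμ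
  obtain ⟨L, hL, hgL⟩ := exists_lipschitz_div_invDensity hθ C.2
    fun x hx y hy => hC.dist_le_mul x hx y hy
  refine ⟨2 * L * θ, by positivity, fun n x hx => ?_⟩
  have := exists_abs_map_iterate_real_sub_le hθ hθ2 hm hL
    (fun x hx => div_nonneg (hd.nonneg x hx) (invDensity_pos hθ hx.1).le) hgL n hx
  rw [← withDensity_eq_densMeasure hθ, ← hd.eq_withDensity, probReal_univ] at this
  rwa [distrib_eq hd]

end ThetaExpansion

theorem mainTheorem1 (m : ℕ) (hm : 0 < m) (θ : ℝ) (hθ0 : 0 < θ) (hθ1 : θ < 1)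
    (hθ : θ ^ 2 = 1 / (m : ℝ)) (μ : Measure ℝ) [IsProbabilityMeasure μ]
    (hA : ThetaExpansion.AssumptionA θ μ) :
    (∀ x ∈ Set.Icc 0 θ,
      (ThetaExpansion.gammaMeasure θ).real (Set.Icc 0 x)
          = 1 / Real.log (1 + θ ^ 2) * Real.log ((m * θ + x) * θ) ∧
      Tendsto (fun n : ℕ => ThetaExpansion.distrib θ μ n x) atTop
        (𝓝 (1 / Real.log (1 + θ ^ 2) * Real.log ((m * θ + x) * θ)))) ∧
    (ThetaExpansion.HasLipschitzDensity θ μ →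
      ∃ (q K : ℝ) (α : ℕ → ℝ → ℝ), 0 < q ∧ q < 1 ∧ 0 < K ∧
        ∀ n : ℕ, 1 ≤ n → ∀ x ∈ Set.Icc 0 θ,
          |α n x| ≤ K ∧
          ThetaExpansion.distrib θ μ n x
            = (1 + α n x * q ^ n) / Real.log (1 + θ ^ 2) * Real.log ((m * θ + x) * θ) ∧
          ThetaExpansion.errorTerm θ μ n x
            = α n x * q ^ n / Real.log (1 + θ ^ 2) * Real.log ((m * θ + x) * θ)) := by
  have hm0 : (0 : ℝ) < m := by exact_mod_cast hm
  have hmθ : θ ^ 2 * m = 1 := by rw [hθ]; field_simp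
  have hm2 : (2 : ℝ) ≤ m := by
    have h1 : (1 : ℝ) < m := by nlinarith
    exact_mod_cast h1
  have hθ2 : θ ^ 2 ≤ 1 / 2 := by
    rw [hθ]; exact one_div_le_one_div_of_le (by norm_num) hm2
  have harg : ∀ x, (m * θ + x) * θ = 1 + θ * x := fun x => by linear_combination hmθ
  simp only [harg, sq θ]
  refine ⟨fun x hx => ⟨ThetaExpansion.gammaMeasure_real_Icc hθ0 hx, ?_⟩, fun hLip => ?_⟩
  · obtain ⟨-, h, hd, -⟩ := hA
    exact ThetaExpansion.tendsto_distrib hθ0 hθ2 hmθ hd hx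
  obtain ⟨K, hK, hbound⟩ := ThetaExpansion.exists_abs_distrib_sub_le hθ0 hθ2 hmθ hLip
  have hG := ThetaExpansion.log_one_add_sq_pos hθ0
  -- `α` is found by solving the required identity; the `+ 1` keeps the bound positive when `K = 0`.
  refine ⟨5 / 6, K * Real.log (1 + θ * θ) + 1,
    fun n x => (ThetaExpansion.distrib θ μ n x
        - 1 / Real.log (1 + θ * θ) * Real.log (1 + θ * x)) * Real.log (1 + θ * θ)
      / ((5 / 6) ^ n * Real.log (1 + θ * x)),
    by norm_num, by norm_num, by positivity, fun n _ x hx => ?_⟩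
  have hb := hbound n x hx
  beta_reduce
  rw [ThetaExpansion.errorTerm, ThetaExpansion.gammaMeasure_real_Icc hθ0 hx]
  have hF := ThetaExpansion.log_one_add_mul_nonneg hθ0 hx.1
  generalize ThetaExpansion.distrib θ μ n x = d at *
  generalize Real.log (1 + θ * x) = F at *
  generalize Real.log (1 + θ * θ) = G at *
  obtain ⟨Q, hQ, hQn⟩ : ∃ Q : ℝ, 0 < Q ∧ (5 / 6 : ℝ) ^ n = Q := ⟨_, by positivity, rfl⟩
  rw [hQn] at hb ⊢
  -- If the logarithm vanishes, division by zero makes `α = 0`, and the bound itself forces `d = 0`.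
  rcases hF.eq_or_lt with rfl | hF
  · have hd : d = 0 := by simpa using hb
    subst hd
    simp only [mul_zero, div_zero, sub_zero, abs_zero, and_self, and_true]
    positivity
  · refine ⟨?_, by field_simp; ring, by field_simp⟩
    rw [abs_div, abs_mul, abs_of_pos hG, abs_of_pos (mul_pos hQ hF), div_le_iff₀ (mul_pos hQ hF)]
    have h1 := mul_le_mul_of_nonneg_right hb hG.le
    have h2 := mul_pos hQ hF
    nlinarith
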